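/- Let $\mu\subseteq\lambda$ be partitions, identified with their Young diagrams $Y_\mu\subseteq Y_\lambda$ (squares $(i,j)$ = (row, column)), and let $Y_{\lambda/\mu}=Y_\lambda\setminus Y_\mu$ be the skew diagram of shape $\lambda/\mu$. A \emph{corner} of $\lambda/\mu$ is a square $(i,j)\in Y_{\lambda/\mu}$ with $(i+1,j),(i,j+1)\notin Y_{\lambda/\mu}$; a \emph{boundary square} of $\lambda$ is a square $(i,j)\in Y_\lambda$ such that at least one of $(i+1,j),(i,j+1)$ is not in $Y_\lambda$; two squares are \emph{adjacent} if they share an edge. For squares $a,b\in Y_{\lambda/\mu}$, let $\mathrm{SYT}(\lambda/\mu-a-b)$ be the set of standard Young tableaux on $S=Y_{\lambda/\mu}\setminus\{a,b\}$, i.e. of bijections $S\to\{1,\dots,|S|\}$ that increase along rows and down columns. Let $x,y$ be corners of $\lambda/\mu$, and let $v,w\in Y_{\lambda/\mu}$ be boundary squares of $\lambda$ adjacent to $x$ and to $y$, respectively. Then $$|\mathrm{SYT}(\lambda/\mu-x-y)|^2\ \ge\ |\mathrm{SYT}(\lambda/\mu-x-v)|\cdot|\mathrm{SYT}(\lambda/\mu-y-w)|.$$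 In particular, if $\lambda$ and $\mu$ are self-conjugate, $x=(i,j)$ is a corner of $\lambda/\mu$, $y=(j,i)$, and $v\in Y_{\lambda/\mu}$ is a boundary square of $\lambda$ adjacent to $x$, then $$|\mathrm{SYT}(\lambda/\mu-x-y)|\ \ge\ |\mathrm{SYT}(\lambda/\mu-x-v)|.$$ -/

import Mathlib

/-- The skew Young diagram `Y_{lam/mu}`: the set of squares of `lam` that are not in `mu`.
Squares are pairs (row, column), counted from `0`. -/
def skewCells (lam mu : YoungDiagram) : Finset (ℕ × ℕ) :=
  lam.cells \ mu.cells

/-- The standard Young tableaux on a finite set `S` of squares: the bijections from `S` onto an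
initial segment of the integers (here `{0, …, n - 1}`, where `n` is the number of squares)
that increase along every row and down every column. -/
def SYT (S : Finset (ℕ × ℕ)) : Set (S ≃ Fin S.card) :=
  {f | (∀ a b : S, a.1.1 = b.1.1 → a.1.2 < b.1.2 → f a < f b) ∧
       (∀ a b : S, a.1.2 = b.1.2 → a.1.1 < b.1.1 → f a < f b)}

/-- The corners of a set `S` of squares: the squares of `S` with neither the square below nor the
square to the right in `S`. -/
def cornerSquares (S : Finset (ℕ × ℕ)) : Set (ℕ × ℕ) :=
  {c | c ∈ S ∧ (c.1 + 1, c.2) ∉ S ∧ (c.1, c.2 + 1) ∉ S}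

/-- The boundary squares of a set `S` of squares: the squares of `S` for which the square below or
the square to the right (or both) is not in `S`. -/
def boundarySquares (S : Finset (ℕ × ℕ)) : Set (ℕ × ℕ) :=
  {c | c ∈ S ∧ ((c.1 + 1, c.2) ∉ S ∨ (c.1, c.2 + 1) ∉ S)}

/-- `b` is the right or the lower neighbour of `a`. -/
def PrecedesAdjacent (a b : ℕ × ℕ) : Prop :=
  b = (a.1, a.2 + 1) ∨ b = (a.1 + 1, a.2)

/-- Two squares are adjacent if they share an edge. -/
def AdjacentSquares (a b : ℕ × ℕ) : Prop :=
  PrecedesAdjacent a b ∨ PrecedesAdjacent b a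

/-! Let `N S` be the number of linear extensions of `S`. The largest label sits at a top (a maximal
element), so `N S` is the sum of `N (S - x)` over the tops `x`. Attach to `S` the symmetric matrix M
on its tops with M_xy = N(S-x-y) for x ≠ y, and with M_xx the sum of N(S-x-v) over those v that
become tops only when x is removed (`pairMatrix`). Corners are tops, and the squares v, w of the
theorem contribute to M_xx and M_yy. For x ≠ y the inequality thus follows from M_xx M_yy ≤ M_xy²,
which holds once M has at most one positive direction (`quadForm_nonpos`); the case x = y is
elementary.

That signature is proved by induction on |S|. The recursion gives M1 = d with d_x = N(S-x).
Expanding the form of M along three successive deletions bounds it by the sum over tops z of the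
forms of S - z (`quadForm_le_sum_quadForm_erase`). By induction each of these satisfies a reverse
Cauchy-Schwarz inequality against the vector 1, and the bounds add up to hᵀMh ≤ Σ (Mh)_z²/d_z. With
D = diag(d), every eigenvalue t of D⁻¹M then satisfies t ≤ t². As M is positive off the diagonal, 1
is the simple largest eigenvalue, so all the others are at most 0
(`Matrix.dotProduct_mulVec_nonpos_of_sq_le`).

In the self-conjugate case, reflection in the diagonal makes the two factors of the product equal.
-/

/-! ### A criterion for at most one positive direction -/

-- A positive maximum m of the Rayleigh quotient of M against D on the hyperplane d ⬝ u = 0 would be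
-- an eigenvalue of D⁻¹M. The hypothesis `hsq` forces m ≥ 1, and a Dirichlet form argument then
-- makes the eigenvector constant, which the hyperplane excludes.
open Matrix in
theorem Matrix.dotProduct_mulVec_nonpos_of_sq_le {ι : Type*} [Fintype ι] (M : Matrix ι ι ℝ)
    (hsymm : Mᵀ = M) (hpos : ∀ x y, x ≠ y → 0 < M x y) (d : ι → ℝ) (hd : M *ᵥ 1 = d)
    (hdpos : ∀ x, 0 < d x)
    (hsq : ∀ h : ι → ℝ, h ⬝ᵥ M *ᵥ h ≤ ∑ x, (M *ᵥ h) x ^ 2 / d x)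
    (h : ι → ℝ) (h0 : d ⬝ᵥ h = 0) : h ⬝ᵥ M *ᵥ h ≤ 0 := by
  classical
  by_contra! hlt
  set D : Matrix ι ι ℝ := diagonal d with hD
  have hDsum : ∀ u : ι → ℝ, u ⬝ᵥ D *ᵥ u = ∑ x, d x * u x ^ 2 := by
    intro u
    simp only [dotProduct, hD, mulVec_diagonal]
    exact Finset.sum_congr rfl fun x _ => by ring
  have hDpos : ∀ u : ι → ℝ, u ≠ 0 → 0 < u ⬝ᵥ D *ᵥ u := by
    intro u hu
    rw [hDsum]
    obtain ⟨x, hx⟩ := Function.ne_iff.mp hu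
    refine Finset.sum_pos' (fun y _ => mul_nonneg (hdpos y).le (sq_nonneg _))
      ⟨x, Finset.mem_univ x, mul_pos (hdpos x) ?_⟩
    have : u x ≠ 0 := hx
    positivity
  have hscale : ∀ (A : Matrix ι ι ℝ) (c : ℝ) (u : ι → ℝ),
      (c • u) ⬝ᵥ A *ᵥ (c • u) = c ^ 2 * (u ⬝ᵥ A *ᵥ u) := by
    intro A c u
    rw [mulVec_smul, smul_dotProduct, dotProduct_smul, smul_eq_mul, smul_eq_mul]
    ring
  have hcont : ∀ A : Matrix ι ι ℝ, Continuous fun u : ι → ℝ => u ⬝ᵥ A *ᵥ u := by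
    intro A
    simp only [dotProduct, mulVec]
    fun_prop
  let K : Set (ι → ℝ) := Metric.sphere 0 1 ∩ {u | d ⬝ᵥ u = 0}
  have hKc : IsCompact K := by
    refine (isCompact_sphere 0 1).inter_right (isClosed_eq (f := fun u : ι → ℝ => d ⬝ᵥ u) ?_ continuous_const)
    simp only [dotProduct]
    fun_prop
  have hnorm : ∀ u : ι → ℝ, u ≠ 0 → d ⬝ᵥ u = 0 → ‖u‖⁻¹ • u ∈ K := by
    intro u hu hdu
    refine ⟨?_, ?_⟩
    · simp [norm_smul, norm_ne_zero_iff.mpr hu]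
    · simp [dotProduct_smul, hdu]
  have hh : h ≠ 0 := by
    rintro rfl
    simp at hlt
  have hK0 : ∀ u ∈ K, u ≠ 0 := by
    rintro u ⟨hu, -⟩ rfl
    simp at hu
  obtain ⟨g, hgK, hgmax⟩ := hKc.exists_isMaxOn ⟨_, hnorm h hh h0⟩
    (f := fun u => (u ⬝ᵥ M *ᵥ u) / (u ⬝ᵥ D *ᵥ u))
    ((hcont M).continuousOn.div (hcont D).continuousOn fun u hu => (hDpos u (hK0 u hu)).ne')
  have hg0 := hK0 g hgK
  have hgd : d ⬝ᵥ g = 0 := hgK.2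
  set m := (g ⬝ᵥ M *ᵥ g) / (g ⬝ᵥ D *ᵥ g) with hm
  have hmg : g ⬝ᵥ M *ᵥ g = m * (g ⬝ᵥ D *ᵥ g) := by
    rw [hm, div_mul_cancel₀ _ (hDpos g hg0).ne']
  have hle : ∀ u : ι → ℝ, d ⬝ᵥ u = 0 → u ⬝ᵥ M *ᵥ u ≤ m * (u ⬝ᵥ D *ᵥ u) := by
    intro u hdu
    rcases eq_or_ne u 0 with rfl | hu
    · simp
    · have h1 : (_ : ℝ) ≤ m := hgmax (hnorm u hu hdu)
      simp only [hscale] at h1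
      have hc : (‖u‖⁻¹) ^ 2 ≠ 0 := by
        have := norm_ne_zero_iff.mpr hu
        positivity
      rwa [mul_div_mul_left _ _ hc, div_le_iff₀ (hDpos u hu)] at h1
  have hm0 : 0 < m := by
    have := hle h h0
    exact pos_of_mul_pos_left (hlt.trans_le this) (hDpos h hh).le
  set P : Matrix ι ι ℝ := m • D - M with hP
  have hPsymm : Pᵀ = P := by simp [hP, hD, hsymm]
  have hPq : ∀ u, u ⬝ᵥ P *ᵥ u = m * (u ⬝ᵥ D *ᵥ u) - u ⬝ᵥ M *ᵥ u := by
    intro u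
    rw [hP, sub_mulVec, dotProduct_sub, smul_mulVec, dotProduct_smul, smul_eq_mul]
  have hPv : ∀ x, (P *ᵥ g) x = m * (d x * g x) - (M *ᵥ g) x := by
    intro x
    rw [hP, sub_mulVec, smul_mulVec, hD]
    simp [mulVec_diagonal]
  have hone : ∀ u : ι → ℝ, ∑ x, (M *ᵥ u) x = d ⬝ᵥ u := by
    intro u
    rw [← hd, ← one_dotProduct, dotProduct_mulVec, ← mulVec_transpose, hsymm]
  -- The gradient direction D⁻¹Pg stays in the hyperplane, so it is an admissible variation of g;
  -- pairing it with Pg gives a weighted sum of squares, whose vanishing is the eigenvector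
  -- equation.
  let u : ι → ℝ := fun x => (P *ᵥ g) x / d x
  have hdu : d ⬝ᵥ u = 0 := by
    have : d ⬝ᵥ u = ∑ x, (P *ᵥ g) x :=
      Finset.sum_congr rfl fun x _ => mul_div_cancel₀ _ (hdpos x).ne'
    rw [this]
    simp only [hPv, Finset.sum_sub_distrib, hone, hgd, ← Finset.mul_sum]
    change m * (d ⬝ᵥ g) - 0 = 0
    simp [hgd]
  have huPg : u ⬝ᵥ P *ᵥ g = ∑ x, (P *ᵥ g) x ^ 2 / d x :=
    Finset.sum_congr rfl fun x _ => by simp only [u]; ring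
  have hexp : ∀ t : ℝ, 0 ≤ 2 * t * (u ⬝ᵥ P *ᵥ g) + t ^ 2 * (u ⬝ᵥ P *ᵥ u) := by
    intro t
    have h1 : 0 ≤ (g + t • u) ⬝ᵥ P *ᵥ (g + t • u) := by
      rw [hPq]
      exact sub_nonneg.mpr (hle _ (by simp [hgd, hdu]))
    have h2 : g ⬝ᵥ P *ᵥ u = u ⬝ᵥ P *ᵥ g := by
      rw [dotProduct_mulVec, ← mulVec_transpose, hPsymm, dotProduct_comm]
    have h3 : g ⬝ᵥ P *ᵥ g = 0 := by rw [hPq, hmg, sub_self]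
    rw [mulVec_add, mulVec_smul, add_dotProduct, dotProduct_add, dotProduct_add,
      smul_dotProduct, smul_dotProduct, dotProduct_smul, dotProduct_smul, h2, h3] at h1
    simp only [smul_eq_mul] at h1
    linarith
  have hzero : u ⬝ᵥ P *ᵥ g ≤ 0 := by
    by_contra! ha
    set a := u ⬝ᵥ P *ᵥ g
    set c := u ⬝ᵥ P *ᵥ u
    have hc : 0 < |c| + 1 := by positivity
    -- A small negative t makes the linear term dominate; |c| + 1 keeps the denominator positive
    -- whatever the sign of c.
    have h1 := hexp (-(a / (|c| + 1)))
    have h2 : 0 < a / (|c| + 1) := div_pos ha hc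
    set s := a / (|c| + 1)
    have h3 : s * (|c| + 1) = a := div_mul_cancel₀ _ hc.ne'
    have h4 : s ^ 2 * c ≤ s ^ 2 * |c| := mul_le_mul_of_nonneg_left (le_abs_self c) (sq_nonneg s)
    have h5 : s ^ 2 * |c| = s * a - s ^ 2 := by rw [← h3]; ring
    nlinarith [mul_pos h2 ha, sq_nonneg s]
  have heig : ∀ x, (M *ᵥ g) x = m * (d x * g x) := by
    intro x
    rw [huPg] at hzero
    have h1 : ∀ x ∈ Finset.univ, 0 ≤ (P *ᵥ g) x ^ 2 / d x :=
      fun x _ => div_nonneg (sq_nonneg _) (hdpos x).le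
    have h2 := (Finset.sum_eq_zero_iff_of_nonneg h1).mp
      (le_antisymm hzero (Finset.sum_nonneg h1)) x (Finset.mem_univ x)
    rw [div_eq_zero_iff, or_iff_left (hdpos x).ne', sq_eq_zero_iff, hPv] at h2
    linarith
  have hm1 : 1 ≤ m := by
    have h1 := hsq g
    have h2 : ∑ x, (M *ᵥ g) x ^ 2 / d x = m * (m * (g ⬝ᵥ D *ᵥ g)) := by
      rw [hDsum, Finset.mul_sum, Finset.mul_sum]
      refine Finset.sum_congr rfl fun x _ => ?_
      rw [heig]
      field_simp [(hdpos x).ne']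
    rw [h2, hmg] at h1
    exact (le_mul_iff_one_le_left (mul_pos hm0 (hDpos g hg0))).mp h1
  -- Dirichlet form of the weights M x y, whose row sums are d. With m ≥ 1 its value is at most 0,
  -- while only the positive off-diagonal entries contribute.
  have hdir : ∑ x, ∑ y, M x y * (g x - g y) ^ 2 = 2 * (g ⬝ᵥ D *ᵥ g - g ⬝ᵥ M *ᵥ g) := by
    have h1 : ∑ x, ∑ y, M x y * g x ^ 2 = g ⬝ᵥ D *ᵥ g := by
      rw [hDsum]
      refine Finset.sum_congr rfl fun x _ => ?_
      rw [← Finset.sum_mul, ← hd]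
      simp [mulVec, dotProduct]
    have h2 : ∑ x, ∑ y, M x y * g y ^ 2 = g ⬝ᵥ D *ᵥ g := by
      rw [← h1, Finset.sum_comm]
      refine Finset.sum_congr rfl fun x _ => Finset.sum_congr rfl fun y _ => ?_
      rw [← congrFun (congrFun hsymm x) y, transpose_apply]
    have h3 : ∑ x, ∑ y, M x y * (g x * g y) = g ⬝ᵥ M *ᵥ g := by
      simp only [dotProduct, mulVec, Finset.mul_sum]
      exact Finset.sum_congr rfl fun x _ => Finset.sum_congr rfl fun y _ => by ring
    have h4 : ∀ x y, M x y * (g x - g y) ^ 2 =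
        M x y * g x ^ 2 + M x y * g y ^ 2 - 2 * (M x y * (g x * g y)) := fun x y => by ring
    simp only [h4, Finset.sum_sub_distrib, Finset.sum_add_distrib, ← Finset.mul_sum, h1, h2, h3]
    ring
  have hnn : ∀ x y, 0 ≤ M x y * (g x - g y) ^ 2 := by
    intro x y
    rcases eq_or_ne x y with rfl | hxy
    · simp
    · exact mul_nonneg (hpos x y hxy).le (sq_nonneg _)
  have hconst : ∀ x y, g x = g y := by
    intro x y
    rcases eq_or_ne x y with rfl | hxy
    · rfl
    have h1 : ∑ x, ∑ y, M x y * (g x - g y) ^ 2 ≤ 0 := by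
      rw [hdir, hmg]
      nlinarith [hDpos g hg0]
    have h2 : M x y * (g x - g y) ^ 2 ≤ 0 := by
      refine le_trans (b := ∑ y, M x y * (g x - g y) ^ 2) ?_ (le_trans ?_ h1)
      · exact Finset.single_le_sum (f := fun y => M x y * (g x - g y) ^ 2)
          (fun y _ => hnn x y) (Finset.mem_univ y)
      · exact Finset.single_le_sum (f := fun x => ∑ y, M x y * (g x - g y) ^ 2)
          (fun x _ => Finset.sum_nonneg fun y _ => hnn x y) (Finset.mem_univ x)
    have h3 : (g x - g y) ^ 2 = 0 := by
      have := hpos x y hxy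
      have h4 := sq_nonneg (g x - g y)
      nlinarith
    exact sub_eq_zero.mp (sq_eq_zero_iff.mp h3)
  obtain ⟨x, hx⟩ := Function.ne_iff.mp hg0
  have h1 : d ⬝ᵥ g = (∑ y, d y) * g x := by
    rw [Finset.sum_mul]
    exact Finset.sum_congr rfl fun y _ => by rw [hconst y x]
  have h2 : 0 < ∑ y, d y := Finset.sum_pos (fun y _ => hdpos y) ⟨x, Finset.mem_univ x⟩
  rw [hgd] at h1
  exact (mul_ne_zero h2.ne' hx) h1.symm

/-! ### Linear extensions and removal of a top -/

section LinearExtensions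

variable {α : Type*} (r : α → α → Prop)

open Classical in
/-- The elements of `S` without `r`-successor in `S`. -/
noncomputable def tops (S : Finset α) : Finset α :=
  S.filter fun x => ∀ y ∈ S, ¬ r x y

/-- The labellings of `S` by `0, …, |S| - 1` that increase along `r`, extended by zero. -/
def linearLabellings (S : Finset α) : Set (α → ℕ) :=
  {g | (∀ a, a ∉ S → g a = 0) ∧ (∀ a ∈ S, g a < S.card) ∧ Set.InjOn g S ∧
    ∀ a ∈ S, ∀ b ∈ S, r a b → g a < g b}

variable {r}

theorem mem_tops {S : Finset α} {x : α} : x ∈ tops r S ↔ x ∈ S ∧ ∀ y ∈ S, ¬ r x y := by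
  simp [tops]

theorem mem_of_mem_tops {S : Finset α} {x : α} (hx : x ∈ tops r S) : x ∈ S :=
  (mem_tops.mp hx).1

theorem tops_subset (S : Finset α) : tops r S ⊆ S := fun _ => mem_of_mem_tops

theorem tops_nonempty (rank : α → ℕ) (hrank : ∀ a b, r a b → rank a < rank b) {S : Finset α}
    (hS : S.Nonempty) : (tops r S).Nonempty := by
  obtain ⟨x, hx, hmax⟩ := S.exists_max_image rank hS
  exact ⟨x, mem_tops.mpr ⟨hx, fun y hy hxy => (hrank x y hxy).not_ge (hmax y hy)⟩⟩

theorem linearLabellings_finite (S : Finset α) : (linearLabellings r S).Finite := by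
  refine Set.finite_coe_iff.mp (Finite.of_injective
    (fun g : linearLabellings r S => fun a : S => (⟨g.1 a, g.2.2.1 a a.2⟩ : Fin S.card)) ?_)
  rintro ⟨g, hg⟩ ⟨g', hg'⟩ h
  refine Subtype.ext (funext fun a => ?_)
  by_cases ha : a ∈ S
  · exact congrArg Fin.val (congrFun h ⟨a, ha⟩)
  · exact (hg.1 a ha).trans (hg'.1 a ha).symm

variable [DecidableEq α]

theorem mem_tops_erase {S : Finset α} {x y : α} (hx : x ∈ tops r S) (hxy : x ≠ y) :
    x ∈ tops r (S.erase y) := by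
  rw [mem_tops] at hx ⊢
  exact ⟨Finset.mem_erase.mpr ⟨hxy, hx.1⟩, fun z hz => hx.2 z (Finset.mem_of_mem_erase hz)⟩

theorem update_mem_linearLabellings {S : Finset α} {x : α} (hx : x ∈ tops r S) (hxx : ¬ r x x)
    {g : α → ℕ} (hg : g ∈ linearLabellings r (S.erase x)) :
    Function.update g x (S.card - 1) ∈ linearLabellings r S := by
  obtain ⟨h0, hlt, hinj, hmono⟩ := hg
  obtain ⟨hxS, hxr⟩ := mem_tops.mp hx
  have hcard : 0 < S.card := Finset.card_pos.mpr ⟨x, hxS⟩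
  rw [Finset.card_erase_of_mem hxS] at hlt
  have hmem : ∀ a ∈ S, a ≠ x → a ∈ S.erase x := fun a ha hax => Finset.mem_erase.mpr ⟨hax, ha⟩
  refine ⟨fun a ha => ?_, fun a ha => ?_, fun a ha b hb hab => ?_, fun a ha b hb hab => ?_⟩
  · have hax : a ≠ x := fun h => ha (h ▸ hxS)
    rw [Function.update_of_ne hax]
    exact h0 a fun h => ha (Finset.mem_of_mem_erase h)
  · rcases eq_or_ne a x with rfl | hax
    · rw [Function.update_self]; omega
    · rw [Function.update_of_ne hax]
      have := hlt a (hmem a ha hax)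
      omega
  · rcases eq_or_ne a x with rfl | hax <;> rcases eq_or_ne b a with rfl | hba
    · rfl
    · rw [Function.update_self, Function.update_of_ne hba] at hab
      have := hlt b (hmem b hb hba)
      omega
    · rfl
    · rcases eq_or_ne b x with rfl | hbx
      · rw [Function.update_self, Function.update_of_ne hax] at hab
        have := hlt a (hmem a ha hax)
        omega
      · rw [Function.update_of_ne hax, Function.update_of_ne hbx] at hab
        exact hinj (hmem a ha hax) (hmem b hb hbx) hab
  · have hax : a ≠ x := by
      rintro rfl
      exact hxr b hb hab
    rw [Function.update_of_ne hax]
    rcases eq_or_ne b x with rfl | hbx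
    · rw [Function.update_self]
      exact hlt a (hmem a ha hax)
    · rw [Function.update_of_ne hbx]
      exact hmono a (hmem a ha hax) b (hmem b hb hbx) hab

theorem exists_update_eq_of_mem_linearLabellings {S : Finset α} (hS : S.Nonempty) {g : α → ℕ}
    (hg : g ∈ linearLabellings r S) :
    ∃ x ∈ tops r S, ∃ g' ∈ linearLabellings r (S.erase x),
      Function.update g' x (S.card - 1) = g := by
  obtain ⟨h0, hlt, hinj, hmono⟩ := hg
  have hcard : 0 < S.card := Finset.card_pos.mpr hS
  have himage : S.image g = Finset.range S.card := by
    refine Finset.eq_of_subset_of_card_le (fun n hn => ?_) ?_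
    · obtain ⟨a, ha, rfl⟩ := Finset.mem_image.mp hn
      exact Finset.mem_range.mpr (hlt a ha)
    · rw [Finset.card_range, Finset.card_image_of_injOn hinj]
  have hlast : S.card - 1 ∈ S.image g := by
    rw [himage, Finset.mem_range]
    omega
  obtain ⟨x, hxS, hx⟩ := Finset.mem_image.mp hlast
  refine ⟨x, mem_tops.mpr ⟨hxS, fun y hy hxy => ?_⟩, Function.update g x 0,
    ⟨fun a ha => ?_, fun a ha => ?_, fun a ha b hb hab => ?_, fun a ha b hb hab => ?_⟩, ?_⟩
  · have h1 := hmono x hxS y hy hxy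
    have h2 := hlt y hy
    omega
  · rcases eq_or_ne a x with rfl | hax
    · simp
    · rw [Function.update_of_ne hax]
      exact h0 a fun h => ha (Finset.mem_erase.mpr ⟨hax, h⟩)
  · obtain ⟨hax, haS⟩ := Finset.mem_erase.mp ha
    rw [Function.update_of_ne hax, Finset.card_erase_of_mem hxS]
    have h1 := hlt a haS
    have h2 : g a ≠ g x := fun h => hax (hinj haS hxS h)
    omega
  · obtain ⟨hax, haS⟩ := Finset.mem_erase.mp ha
    obtain ⟨hbx, hbS⟩ := Finset.mem_erase.mp hb
    rw [Function.update_of_ne hax, Function.update_of_ne hbx] at hab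
    exact hinj haS hbS hab
  · obtain ⟨hax, haS⟩ := Finset.mem_erase.mp ha
    obtain ⟨hbx, hbS⟩ := Finset.mem_erase.mp hb
    rw [Function.update_of_ne hax, Function.update_of_ne hbx]
    exact hmono a haS b hbS hab
  · rw [Function.update_idem, ← hx, Function.update_eq_self]

/-- Labellings are classified by the position of the largest label `S.card - 1`, which must be a
top; removing it leaves a labelling of the rest. -/
theorem ncard_linearLabellings_eq_sum (hirr : ∀ a, ¬ r a a) {S : Finset α} (hS : S.Nonempty) :
    (linearLabellings r S).ncard =
      ∑ x ∈ tops r S, (linearLabellings r (S.erase x)).ncard := by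
  have hunion : linearLabellings r S = ⋃ x ∈ tops r S,
      (fun g => Function.update g x (S.card - 1)) '' linearLabellings r (S.erase x) := by
    ext g
    simp only [Set.mem_iUnion, Set.mem_image, exists_prop]
    refine ⟨exists_update_eq_of_mem_linearLabellings hS, ?_⟩
    rintro ⟨x, hx, g', hg', rfl⟩
    exact update_mem_linearLabellings hx (hirr x) hg'
  have hdisj : (↑(tops r S) : Set α).PairwiseDisjoint fun x =>
      (fun g => Function.update g x (S.card - 1)) '' linearLabellings r (S.erase x) := by
    intro x hx y hy hxy
    refine Set.disjoint_left.mpr ?_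
    rintro _ ⟨g, hg, rfl⟩ ⟨g', hg', heq⟩
    have hmem := update_mem_linearLabellings hx (hirr x) hg
    have hval := congrFun heq y
    simp only [Function.update_self] at hval
    refine hxy (hmem.2.2.1 (mem_of_mem_tops hx) (mem_of_mem_tops hy) ?_)
    rw [Function.update_self]
    exact hval
  have hfin := (tops r S).finite_toSet.ncard_biUnion
    (fun x _ => (linearLabellings_finite _).image _) hdisj
  simp only [Finset.mem_coe, finsum_mem_finset_eq_sum] at hfin
  rw [hunion, hfin]
  refine Finset.sum_congr rfl fun x hx => Set.InjOn.ncard_image fun g hg g' hg' h => ?_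
  funext a
  rcases eq_or_ne a x with rfl | hax
  -- At the erased element both labellings have the default value 0, so overwriting it loses no
  -- information.
  · rw [hg.1 a (Finset.notMem_erase a S), hg'.1 a (Finset.notMem_erase a S)]
  · simpa [Function.update_of_ne hax] using congrFun h a

theorem ncard_linearLabellings_pos (rank : α → ℕ) (hrank : ∀ a b, r a b → rank a < rank b)
    (S : Finset α) : 0 < (linearLabellings r S).ncard := by
  induction S using Finset.strongInduction with
  | H S ih =>
    rcases S.eq_empty_or_nonempty with rfl | hS
    · exact (Set.ncard_pos (linearLabellings_finite _)).mpr ⟨0, by simp [linearLabellings]⟩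
    · rw [ncard_linearLabellings_eq_sum (fun a h => (hrank a a h).ne rfl) hS]
      exact Finset.sum_pos (fun x hx => ih _ (Finset.erase_ssubset (mem_of_mem_tops hx)))
        (tops_nonempty rank hrank hS)

end LinearExtensions

/-! ### Quadratic forms of recursive counts -/

theorem Finset.sum_rotate {α : Type*} (S : Finset α) (G : α → α → α → ℝ) :
    ∑ a ∈ S, ∑ b ∈ S, ∑ c ∈ S, G b c a = ∑ a ∈ S, ∑ b ∈ S, ∑ c ∈ S, G a b c := by
  rw [Finset.sum_comm]
  exact Finset.sum_congr rfl fun b _ => Finset.sum_comm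

section RecursiveCounts

variable {α : Type*} [DecidableEq α] (r : α → α → Prop) (N : Finset α → ℝ)

open Classical in
/-- The function on the tops of `S.erase x` induced by `h`: a top that is not yet a top of `S`
inherits the value at `x`. -/
noncomputable def eraseExtend (S : Finset α) (x : α) (h : α → ℝ) : α → ℝ :=
  fun y => if y ∈ tops r S then h y else h x

/-- The linear form whose coefficient at a top `x` of `S` is `N (S.erase x)`. -/
noncomputable def linForm (S : Finset α) (h : α → ℝ) : ℝ :=
  ∑ x ∈ tops r S, N (S.erase x) * h x

/-- The quadratic form that counts by the first two erased elements. -/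
noncomputable def quadForm (S : Finset α) (h : α → ℝ) : ℝ :=
  ∑ x ∈ tops r S, h x * linForm r N (S.erase x) (eraseExtend r S x h)

/-- The matrix of `quadForm`. -/
noncomputable def pairMatrix (S : Finset α) : Matrix (tops r S) (tops r S) ℝ :=
  fun x y => if (x : α) = y then ∑ v ∈ tops r (S.erase x) \ tops r S, N ((S.erase x).erase v)
    else N ((S.erase x).erase y)

variable {r N}

-- The tops of `S.erase x` are the other tops of `S` and the newly exposed ones. The latter all
-- carry the value `h x`, which is why their counts collect on the diagonal.
open Matrix in
theorem pairMatrix_mulVec (S : Finset α) (h : α → ℝ) (x : tops r S) :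
    (pairMatrix r N S *ᵥ fun y => h y) x = linForm r N (S.erase x) (eraseExtend r S x h) := by
  have hsub : (tops r S).erase x ⊆ tops r (S.erase x) := fun y hy =>
    mem_tops_erase (Finset.mem_of_mem_erase hy) (Finset.ne_of_mem_erase hy)
  have hsdiff : tops r (S.erase x) \ (tops r S).erase x = tops r (S.erase x) \ tops r S := by
    ext v
    simp only [Finset.mem_sdiff, Finset.mem_erase, not_and, and_congr_right_iff]
    refine fun hv => ⟨fun hn => hn ?_, fun hn _ => hn⟩
    exact Finset.ne_of_mem_erase (mem_of_mem_tops hv)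
  have hsum : (pairMatrix r N S *ᵥ fun y => h y) x = ∑ y ∈ tops r S, (if (x : α) = y then
      ∑ v ∈ tops r (S.erase x) \ tops r S, N ((S.erase x).erase v)
      else N ((S.erase x).erase y)) * h y :=
    Finset.sum_coe_sort (tops r S) fun y => (if (x : α) = y then
      ∑ v ∈ tops r (S.erase x) \ tops r S, N ((S.erase x).erase v)
      else N ((S.erase x).erase y)) * h y
  rw [hsum, linForm, ← Finset.sum_sdiff hsub, hsdiff, ← Finset.add_sum_erase _ _ x.2,
    if_pos rfl, Finset.sum_mul]
  congr 1
  · refine Finset.sum_congr rfl fun v hv => ?_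
    rw [eraseExtend, if_neg (Finset.mem_sdiff.mp hv).2]
  · refine Finset.sum_congr rfl fun y hy => ?_
    rw [eraseExtend, if_pos (Finset.mem_of_mem_erase hy),
      if_neg (Finset.ne_of_mem_erase hy).symm]

open Matrix in
theorem quadForm_eq (S : Finset α) (h : α → ℝ) :
    quadForm r N S h =
      (fun x : tops r S => h x) ⬝ᵥ pairMatrix r N S *ᵥ fun x : tops r S => h x := by
  simp only [dotProduct, pairMatrix_mulVec]
  exact (Finset.sum_coe_sort (tops r S)
    fun x => h x * linForm r N (S.erase x) (eraseExtend r S x h)).symm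

theorem pairMatrix_transpose (S : Finset α) : (pairMatrix r N S).transpose = pairMatrix r N S := by
  ext x y
  rw [Matrix.transpose_apply]
  rcases eq_or_ne x y with rfl | hxy
  · rfl
  · have h1 : (x : α) ≠ y := fun h => hxy (Subtype.ext h)
    simp [pairMatrix, h1, h1.symm, Finset.erase_right_comm (a := (x : α))]

theorem linForm_sub_const
    (hrec : ∀ S : Finset α, S.Nonempty → N S = ∑ x ∈ tops r S, N (S.erase x))
    {S : Finset α} (hS : S.Nonempty) (h : α → ℝ) (c : ℝ) :
    linForm r N S (fun a => h a - c) = linForm r N S h - c * N S := by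
  rw [hrec S hS]
  simp only [linForm, mul_sub, Finset.sum_sub_distrib, ← Finset.sum_mul]
  ring

theorem linForm_one (hrec : ∀ S : Finset α, S.Nonempty → N S = ∑ x ∈ tops r S, N (S.erase x))
    {S : Finset α} (hS : S.Nonempty) : linForm r N S 1 = N S := by
  rw [hrec S hS]
  simp [linForm]

theorem erase_nonempty_of_two_le_card {S : Finset α} (hS : 2 ≤ S.card) (x : α) :
    (S.erase x).Nonempty := by
  have := Finset.pred_card_le_card_erase (s := S) (a := x)
  exact Finset.card_pos.mp (by omega)

open Matrix in
theorem pairMatrix_mulVec_one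
    (hrec : ∀ S : Finset α, S.Nonempty → N S = ∑ x ∈ tops r S, N (S.erase x))
    {S : Finset α} (hS : 2 ≤ S.card) :
    pairMatrix r N S *ᵥ 1 = fun x : tops r S => N (S.erase x) := by
  ext x
  have h1 : eraseExtend r S x 1 = 1 := by
    ext y
    simp [eraseExtend]
  have h2 := pairMatrix_mulVec (r := r) (N := N) S 1 x
  rw [h1, linForm_one hrec (erase_nonempty_of_two_le_card hS _)] at h2
  exact h2

-- By symmetry of M, 1ᵀMh = (M1)ᵀh, and M1 is the coefficient vector of the linear form.
open Matrix in
theorem sum_linForm_eraseExtend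
    (hrec : ∀ S : Finset α, S.Nonempty → N S = ∑ x ∈ tops r S, N (S.erase x))
    {S : Finset α} (hS : 2 ≤ S.card) (h : α → ℝ) :
    ∑ x ∈ tops r S, linForm r N (S.erase x) (eraseExtend r S x h) = linForm r N S h := by
  have h1 : (1 : tops r S → ℝ) ⬝ᵥ pairMatrix r N S *ᵥ (fun x : tops r S => h x) =
      ∑ x ∈ tops r S, linForm r N (S.erase x) (eraseExtend r S x h) := by
    rw [one_dotProduct]
    simp only [pairMatrix_mulVec]
    exact Finset.sum_coe_sort (tops r S) fun x => linForm r N (S.erase x) (eraseExtend r S x h)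
  rw [← h1, dotProduct_mulVec, ← mulVec_transpose, pairMatrix_transpose,
    pairMatrix_mulVec_one hrec hS]
  exact Finset.sum_coe_sort (tops r S) fun x => N (S.erase x) * h x

theorem quadForm_sub_const
    (hrec : ∀ S : Finset α, S.Nonempty → N S = ∑ x ∈ tops r S, N (S.erase x))
    {S : Finset α} (hS : 2 ≤ S.card) (h : α → ℝ) (c : ℝ) :
    quadForm r N S (fun a => h a - c) =
      quadForm r N S h - 2 * c * linForm r N S h + c ^ 2 * N S := by
  have h1 : ∀ x, eraseExtend r S x (fun a => h a - c) = fun a => eraseExtend r S x h a - c := by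
    intro x
    ext y
    simp only [eraseExtend]
    split_ifs <;> rfl
  have h2 : ∀ x, (h x - c) * (linForm r N (S.erase x) (eraseExtend r S x h) - c * N (S.erase x)) =
      h x * linForm r N (S.erase x) (eraseExtend r S x h) - c * (N (S.erase x) * h x)
        - c * linForm r N (S.erase x) (eraseExtend r S x h) + c ^ 2 * N (S.erase x) :=
    fun x => by ring
  rw [quadForm]
  simp only [h1, linForm_sub_const hrec (erase_nonempty_of_two_le_card hS _), h2,
    Finset.sum_add_distrib, Finset.sum_sub_distrib, ← Finset.mul_sum,
    sum_linForm_eraseExtend hrec hS, ← hrec S (Finset.card_pos.mp (by omega))]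
  change quadForm r N S h - c * linForm r N S h - _ + _ = _
  ring

/-- Reverse Cauchy-Schwarz: both forms take the value `N S` at the constant 1, so subtracting the
constant `linForm r N S h / N S` moves h into the kernel of the linear form, where `hneg` applies.
-/
theorem quadForm_le_linForm_sq_div
    (hrec : ∀ S : Finset α, S.Nonempty → N S = ∑ x ∈ tops r S, N (S.erase x))
    {S : Finset α} (hS : 2 ≤ S.card) (hN : 0 < N S)
    (hneg : ∀ h, linForm r N S h = 0 → quadForm r N S h ≤ 0) (h : α → ℝ) :
    quadForm r N S h ≤ linForm r N S h ^ 2 / N S := by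
  have h1 := hneg (fun a => h a - linForm r N S h / N S) (by
    rw [linForm_sub_const hrec (Finset.card_pos.mp (by omega)), div_mul_cancel₀ _ hN.ne', sub_self])
  rw [quadForm_sub_const hrec hS] at h1
  have h2 : 2 * (linForm r N S h / N S) * linForm r N S h - (linForm r N S h / N S) ^ 2 * N S =
      linForm r N S h ^ 2 / N S := by
    field_simp
    ring
  linarith

theorem sum_eq_sum_ite_of_subset {S T : Finset α} (hT : T ⊆ S) (f : α → ℝ) :
    ∑ x ∈ T, f x = ∑ x ∈ S, if x ∈ T then f x else 0 := by
  rw [Finset.sum_ite_mem, Finset.inter_eq_right.mpr hT]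

-- Moving the membership conditions into an indicator frees the three indices, so that they can be
-- permuted.
open Classical in
theorem sum_words_eq (S : Finset α) (G : α → α → α → ℝ) :
    ∑ a ∈ tops r S, ∑ b ∈ tops r (S.erase a), ∑ c ∈ tops r ((S.erase a).erase b), G a b c =
      ∑ a ∈ S, ∑ b ∈ S, ∑ c ∈ S, if a ∈ tops r S ∧ b ∈ tops r (S.erase a) ∧
        c ∈ tops r ((S.erase a).erase b) then G a b c else 0 := by
  rw [sum_eq_sum_ite_of_subset (tops_subset S)]
  refine Finset.sum_congr rfl fun a _ => ?_
  rw [sum_eq_sum_ite_of_subset ((tops_subset _).trans (Finset.erase_subset a S))]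
  by_cases ha : a ∈ tops r S
  · rw [if_pos ha]
    refine Finset.sum_congr rfl fun b _ => ?_
    rw [sum_eq_sum_ite_of_subset ((tops_subset _).trans
      ((Finset.erase_subset b _).trans (Finset.erase_subset a S)))]
    by_cases hb : b ∈ tops r (S.erase a) <;> simp [ha, hb]
  · simp [ha]

/-- A successor of c in S would survive the deletion of a or that of b. -/
theorem mem_tops_of_mem_tops_erase {S : Finset α} {a b c : α} (hab : a ≠ b)
    (h1 : c ∈ tops r (S.erase a)) (h2 : c ∈ tops r (S.erase b)) : c ∈ tops r S := by
  rw [mem_tops] at h1 h2 ⊢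
  refine ⟨Finset.mem_of_mem_erase h1.1, fun y hy => ?_⟩
  rcases eq_or_ne y a with rfl | hya
  · exact h2.2 y (Finset.mem_erase.mpr ⟨hab, hy⟩)
  · exact h1.2 y (Finset.mem_erase.mpr ⟨hya, hy⟩)

-- Both sides become sums over words abc of three successive deletions, with a common weight F that
-- is symmetric in the letters. The difference of the summands consists of terms that cancel under
-- cyclic rotation of the word and a remainder that is a sum of squares after exchanging a and b.
open Classical in
theorem quadForm_le_sum_quadForm_erase (hN : ∀ S : Finset α, 0 < N S)
    (hrec : ∀ S : Finset α, S.Nonempty → N S = ∑ x ∈ tops r S, N (S.erase x))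
    {S : Finset α} (hS : 3 ≤ S.card) (h : α → ℝ) :
    quadForm r N S h ≤ ∑ z ∈ tops r S, quadForm r N (S.erase z) (eraseExtend r S z h) := by
  set F : α → α → α → ℝ := fun a b c => N (((S.erase a).erase b).erase c) with hF
  have hFrot : ∀ a b c, F b c a = F a b c := by
    intro a b c
    simp only [hF]
    rw [Finset.erase_right_comm (a := c) (b := a), Finset.erase_right_comm (a := b) (b := a)]
  have hFswap : ∀ a b c, F b a c = F a b c := by
    intro a b c
    simp only [hF]
    rw [Finset.erase_right_comm (a := b) (b := a)]
  let WL : α → α → α → ℝ := fun a b c => eraseExtend r S a h b *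
    eraseExtend r (S.erase a) b (eraseExtend r S a h) c
  let WR : α → α → α → ℝ := fun a b _ => h a * eraseExtend r S a h b
  have hL : ∑ z ∈ tops r S, quadForm r N (S.erase z) (eraseExtend r S z h) =
      ∑ a ∈ tops r S, ∑ b ∈ tops r (S.erase a), ∑ c ∈ tops r ((S.erase a).erase b),
        F a b c * WL a b c := by
    refine Finset.sum_congr rfl fun a _ => Finset.sum_congr rfl fun b _ => ?_
    rw [linForm, Finset.mul_sum]
    exact Finset.sum_congr rfl fun c _ => by simp only [hF, WL]; ring
  have hR : quadForm r N S h =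
      ∑ a ∈ tops r S, ∑ b ∈ tops r (S.erase a), ∑ c ∈ tops r ((S.erase a).erase b),
        F a b c * WR a b c := by
    refine Finset.sum_congr rfl fun a _ => ?_
    rw [linForm, Finset.mul_sum]
    refine Finset.sum_congr rfl fun b _ => ?_
    have hcard : ((S.erase a).erase b).Nonempty := by
      refine erase_nonempty_of_two_le_card ?_ b
      have := Finset.pred_card_le_card_erase (s := S) (a := a)
      omega
    rw [hrec _ hcard, Finset.sum_mul, Finset.mul_sum]
    exact Finset.sum_congr rfl fun c _ => by simp only [hF, WR]; ring
  -- `D₁`: b is exposed by a, and c was a top from the start. `E`: three distinct tops of S. `D₂`: c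
  -- is exposed only when both a and b are gone. In every other admissible word the two weights
  -- agree, or their difference is a rotated `D₁`.
  let D₁ : α → α → α → ℝ := fun a b c => if a ∈ tops r S ∧ b ∉ tops r S ∧
    b ∈ tops r (S.erase a) ∧ c ∈ tops r S ∧ c ≠ a then F a b c * (h a * (h c - h a)) else 0
  let E : α → α → α → ℝ := fun a b c => if a ∈ tops r S ∧ b ∈ tops r S ∧ c ∈ tops r S ∧
    a ≠ b ∧ b ≠ c ∧ c ≠ a then F a b c * (h a * h b) else 0
  let D₂ : α → α → α → ℝ := fun a b c => if a ∈ tops r S ∧ b ∈ tops r S ∧ a ≠ b ∧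
    c ∉ tops r (S.erase a) ∧ c ∉ tops r (S.erase b) ∧ c ∈ tops r ((S.erase a).erase b)
    then F a b c * (h b * (h b - h a)) else 0
  have hdecomp : ∀ a b c, (if a ∈ tops r S ∧ b ∈ tops r (S.erase a) ∧
      c ∈ tops r ((S.erase a).erase b) then F a b c * WL a b c - F a b c * WR a b c else 0) =
      D₁ a b c - D₁ b c a + (E b c a - E a b c) + D₂ a b c := by
    intro a b c
    simp only [D₁, E, D₂, hFrot]
    by_cases ha : a ∈ tops r S
    swap
    · simp [ha]
    by_cases hb : b ∈ tops r S
    · rcases eq_or_ne a b with rfl | hab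
      · have : a ∉ tops r (S.erase a) := fun h => Finset.notMem_erase a S (mem_of_mem_tops h)
        simp [this]
      have hb' := mem_tops_erase hb hab.symm
      by_cases hc : c ∈ tops r S
      · rcases eq_or_ne c a with rfl | hca
        · have : c ∉ tops r ((S.erase c).erase b) := fun h =>
            Finset.notMem_erase c S (Finset.mem_of_mem_erase (mem_of_mem_tops h))
          simp [this, hb, hc]
        rcases eq_or_ne c b with rfl | hcb
        · have : c ∉ tops r ((S.erase a).erase c) := fun h =>
            Finset.notMem_erase c _ (mem_of_mem_tops h)
          simp [this, hb]
        have hc' := mem_tops_erase hc hca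
        have hc'' := mem_tops_erase hc' hcb
        have hc''' := mem_tops_erase hc hcb
        simp [ha, hb, hc, hab, hca, hcb.symm, hb', hc', hc'', hc''', WL, WR, eraseExtend]
      · by_cases h1 : c ∈ tops r (S.erase a)
        · have h2 : c ∉ tops r (S.erase b) := fun h2 =>
            hc (mem_tops_of_mem_tops_erase hab h1 h2)
          have hcb : c ≠ b := fun h => hc (h ▸ hb)
          have h3 := mem_tops_erase h1 hcb
          simp [ha, hb, hc, h1, h2, h3, hb', WL, WR, eraseExtend]
          ring
        · by_cases h2 : c ∈ tops r (S.erase b)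
          · have hca : c ≠ a := fun h => hc (h ▸ ha)
            have h3 := mem_tops_erase h2 hca
            rw [Finset.erase_right_comm] at h3
            simp [ha, hb, hc, h1, h2, h3, hb', hab, WL, WR, eraseExtend]
            ring
          · by_cases h3 : c ∈ tops r ((S.erase a).erase b)
            · simp [ha, hb, hc, h1, h2, h3, hb', hab, WL, WR, eraseExtend]
              ring
            · simp [hb, hc, h2, h3]
    · by_cases hb' : b ∈ tops r (S.erase a)
      swap
      · simp [hb, hb']
      by_cases hc : c ∈ tops r S
      · rcases eq_or_ne c a with rfl | hca
        · have : c ∉ tops r ((S.erase c).erase b) := fun h =>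
            Finset.notMem_erase c S (Finset.mem_of_mem_erase (mem_of_mem_tops h))
          simp [this, hb]
        have hcb : c ≠ b := fun h => hb (h ▸ hc)
        have hc' := mem_tops_erase hc hca
        have hc'' := mem_tops_erase hc' hcb
        simp [ha, hb, hc, hb', hca, hc', hc'', WL, WR, eraseExtend]
        ring
      · simp [ha, hb, hc, hb', WL, WR, eraseExtend]
  have hD₂ : 0 ≤ ∑ a ∈ S, ∑ b ∈ S, ∑ c ∈ S, D₂ a b c := by
    have h1 : ∑ a ∈ S, ∑ b ∈ S, ∑ c ∈ S, D₂ b a c = ∑ a ∈ S, ∑ b ∈ S, ∑ c ∈ S, D₂ a b c :=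
      Finset.sum_comm
    -- Adding the term with a and b exchanged gives F a b c (h a - h b)².
    have h2 : 0 ≤ ∑ a ∈ S, ∑ b ∈ S, ∑ c ∈ S, (D₂ a b c + D₂ b a c) := by
      refine Finset.sum_nonneg fun a _ => Finset.sum_nonneg fun b _ =>
        Finset.sum_nonneg fun c _ => ?_
      have hiff : (b ∈ tops r S ∧ a ∈ tops r S ∧ b ≠ a ∧ c ∉ tops r (S.erase b) ∧
          c ∉ tops r (S.erase a) ∧ c ∈ tops r ((S.erase b).erase a)) ↔
          (a ∈ tops r S ∧ b ∈ tops r S ∧ a ≠ b ∧ c ∉ tops r (S.erase a) ∧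
          c ∉ tops r (S.erase b) ∧ c ∈ tops r ((S.erase a).erase b)) := by
        rw [Finset.erase_right_comm, ne_comm]
        tauto
      simp only [D₂, hiff, hFswap]
      split_ifs
      · have h3 : F a b c * (h b * (h b - h a)) + F a b c * (h a * (h a - h b)) =
            F a b c * (h a - h b) ^ 2 := by ring
        rw [h3]
        exact mul_nonneg (hN _).le (sq_nonneg _)
      · simp
    simp only [Finset.sum_add_distrib, h1] at h2
    linarith
  rw [← sub_nonneg, hL, hR]
  simp only [← Finset.sum_sub_distrib]
  rw [sum_words_eq]
  simp only [hdecomp, Finset.sum_add_distrib, Finset.sum_sub_distrib]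
  rw [Finset.sum_rotate S D₁, Finset.sum_rotate S E]
  simpa using hD₂

end RecursiveCounts

/-! ### Induction for the signature and the two-by-two minor -/

section RecursiveCounts

variable {α : Type*} [DecidableEq α] {r : α → α → Prop} {N : Finset α → ℝ}

/-- Base case, too small for words of three deletions. Two tops give 2 h(a) h(b) ≤ h(a)² + h(b)²,
scaled by `N ∅`; one top gives equality. -/
theorem quadForm_le_sum_sq_of_card_eq_two (hN : ∀ S : Finset α, 0 < N S)
    (hrec : ∀ S : Finset α, S.Nonempty → N S = ∑ x ∈ tops r S, N (S.erase x))
    {S : Finset α} (hS : S.card = 2) (h : α → ℝ) :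
    quadForm r N S h ≤ ∑ x ∈ tops r S,
      linForm r N (S.erase x) (eraseExtend r S x h) ^ 2 / N (S.erase x) := by
  -- Without tops the recursion would give an empty sum, against positivity of N.
  have htops : ∀ T : Finset α, T.Nonempty → (tops r T).Nonempty := by
    intro T hT
    by_contra hne
    have h1 := hrec T hT
    rw [Finset.not_nonempty_iff_eq_empty.mp hne, Finset.sum_empty] at h1
    exact (hN T).ne' h1
  have hsingle : ∀ y : α, tops r {y} = {y} := fun y =>
    (Finset.Nonempty.subset_singleton_iff (htops _ (Finset.singleton_nonempty y))).mp
      (tops_subset _)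
  have hN1 : ∀ y : α, N {y} = N ∅ := by
    intro y
    rw [hrec _ (Finset.singleton_nonempty y), hsingle]
    simp
  have hlin : ∀ (y : α) (g : α → ℝ), linForm r N {y} g = N ∅ * g y := by
    intro y g
    rw [linForm, hsingle]
    simp
  have hN0 := hN ∅
  obtain ⟨a, b, hab, rfl⟩ := Finset.card_eq_two.mp hS
  have hea : ({a, b} : Finset α).erase a = {b} := by
    ext x
    simp only [Finset.mem_erase, Finset.mem_insert, Finset.mem_singleton]
    constructor
    · tauto
    · rintro rfl
      exact ⟨hab.symm, Or.inr rfl⟩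
  have heb : ({a, b} : Finset α).erase b = {a} := by
    ext x
    simp only [Finset.mem_erase, Finset.mem_insert, Finset.mem_singleton]
    constructor
    · tauto
    · rintro rfl
      exact ⟨hab, Or.inl rfl⟩
  have hsq : ∀ t : ℝ, (N ∅ * t) ^ 2 / N ∅ = N ∅ * t ^ 2 := by
    intro t
    field_simp
  rw [quadForm]
  by_cases ha : a ∈ tops r {a, b} <;> by_cases hb : b ∈ tops r {a, b}
  · have ht : tops r {a, b} = {a, b} := Finset.Subset.antisymm (tops_subset _) (by
      intro x hx
      rcases Finset.mem_insert.mp hx with rfl | hx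
      · exact ha
      · rwa [Finset.mem_singleton.mp hx])
    rw [ht, Finset.sum_pair hab, Finset.sum_pair hab, hea, heb]
    simp only [hlin, hN1, hsq, eraseExtend, ha, hb, if_true]
    nlinarith [mul_nonneg hN0.le (sq_nonneg (h a - h b))]
  · have ht : tops r {a, b} = {a} := by
      refine (Finset.Nonempty.subset_singleton_iff ⟨a, ha⟩).mp fun x hx => ?_
      have := tops_subset _ hx
      simp only [Finset.mem_insert, Finset.mem_singleton] at this ⊢
      exact this.resolve_right fun h => hb (h ▸ hx)
    rw [ht, Finset.sum_singleton, Finset.sum_singleton, hea]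
    simp only [hlin, hN1, hsq, eraseExtend, hb, if_false]
    exact le_of_eq (by ring)
  · have ht : tops r {a, b} = {b} := by
      refine (Finset.Nonempty.subset_singleton_iff ⟨b, hb⟩).mp fun x hx => ?_
      have := tops_subset _ hx
      simp only [Finset.mem_insert, Finset.mem_singleton] at this ⊢
      exact this.resolve_left fun h => ha (h ▸ hx)
    rw [ht, Finset.sum_singleton, Finset.sum_singleton, heb]
    simp only [hlin, hN1, hsq, eraseExtend, ha, if_false]
    exact le_of_eq (by ring)
  · obtain ⟨x, hx⟩ := htops {a, b} ⟨a, Finset.mem_insert_self a _⟩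
    have := tops_subset _ hx
    simp only [Finset.mem_insert, Finset.mem_singleton] at this
    rcases this with rfl | rfl
    · exact absurd hx ha
    · exact absurd hx hb

open Matrix in
theorem quadForm_nonpos_of_le_sum_sq (hN : ∀ S : Finset α, 0 < N S)
    (hrec : ∀ S : Finset α, S.Nonempty → N S = ∑ x ∈ tops r S, N (S.erase x))
    {S : Finset α} (hS : 2 ≤ S.card)
    (hsq : ∀ h : α → ℝ, quadForm r N S h ≤ ∑ x ∈ tops r S,
      linForm r N (S.erase x) (eraseExtend r S x h) ^ 2 / N (S.erase x))
    (h : α → ℝ) (h0 : linForm r N S h = 0) : quadForm r N S h ≤ 0 := by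
  rw [quadForm_eq]
  refine dotProduct_mulVec_nonpos_of_sq_le _ (pairMatrix_transpose S) ?_ _
    (pairMatrix_mulVec_one hrec hS) (fun x => hN _) ?_ _ ?_
  · intro x y hxy
    rw [pairMatrix, if_neg fun h => hxy (Subtype.ext h)]
    exact hN _
  · intro g
    let g' : α → ℝ := fun a => if ha : a ∈ tops r S then g ⟨a, ha⟩ else 0
    have hg : g = fun x : tops r S => g' x := by
      ext x
      simp [g']
    rw [hg, ← quadForm_eq]
    refine (hsq g').trans_eq ?_
    simp only [pairMatrix_mulVec]
    exact (Finset.sum_coe_sort (tops r S) fun x =>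
      linForm r N (S.erase x) (eraseExtend r S x g') ^ 2 / N (S.erase x)).symm
  · rw [← h0]
    exact Finset.sum_coe_sort (tops r S) fun x => N (S.erase x) * h x

/-- The quadratic form has at most one positive direction. -/
theorem quadForm_nonpos (hN : ∀ S : Finset α, 0 < N S)
    (hrec : ∀ S : Finset α, S.Nonempty → N S = ∑ x ∈ tops r S, N (S.erase x))
    (S : Finset α) (h : α → ℝ) (h0 : linForm r N S h = 0) : quadForm r N S h ≤ 0 := by
  induction S using Finset.strongInduction generalizing h with
  | H S ih =>
    rcases Nat.lt_or_ge S.card 2 with hS | hS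
    · refine le_of_eq (Finset.sum_eq_zero fun x hx => ?_)
      have hempty : S.erase x = ∅ := by
        rw [← Finset.card_eq_zero, Finset.card_erase_of_mem (mem_of_mem_tops hx)]
        omega
      rw [hempty, linForm, Finset.subset_empty.mp (tops_subset (r := r) ∅), Finset.sum_empty,
        mul_zero]
    · refine quadForm_nonpos_of_le_sum_sq hN hrec hS (fun g => ?_) h h0
      rcases Nat.lt_or_ge 2 S.card with hS3 | hS2
      · refine (quadForm_le_sum_quadForm_erase hN hrec hS3 g).trans
          (Finset.sum_le_sum fun x hx => ?_)
        have hxS := mem_of_mem_tops hx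
        refine quadForm_le_linForm_sq_div hrec ?_ (hN _)
          (ih _ (Finset.erase_ssubset hxS)) _
        rw [Finset.card_erase_of_mem hxS]
        omega
      · exact quadForm_le_sum_sq_of_card_eq_two hN hrec (le_antisymm hS2 hS) g

open Matrix in
theorem sum_mul_sum_le_sq (hN : ∀ S : Finset α, 0 < N S)
    (hrec : ∀ S : Finset α, S.Nonempty → N S = ∑ x ∈ tops r S, N (S.erase x))
    {S : Finset α} {x y : α} (hx : x ∈ tops r S) (hy : y ∈ tops r S) (hxy : x ≠ y) :
    (∑ v ∈ tops r (S.erase x) \ tops r S, N ((S.erase x).erase v)) *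
      (∑ w ∈ tops r (S.erase y) \ tops r S, N ((S.erase y).erase w)) ≤
      N ((S.erase x).erase y) ^ 2 := by
  set p := ∑ v ∈ tops r (S.erase x) \ tops r S, N ((S.erase x).erase v) with hp
  set q := ∑ w ∈ tops r (S.erase y) \ tops r S, N ((S.erase y).erase w) with hq
  set m := N ((S.erase x).erase y) with hm
  set s := N (S.erase x)
  set t := N (S.erase y)
  have hp0 : 0 ≤ p := Finset.sum_nonneg fun v _ => (hN _).le
  have hq0 : 0 ≤ q := Finset.sum_nonneg fun v _ => (hN _).le
  have hm0 : 0 < m := hN _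
  have hs : 0 < s := hN _
  have ht : 0 < t := hN _
  let x' : tops r S := ⟨x, hx⟩
  let y' : tops r S := ⟨y, hy⟩
  have hxy' : x' ≠ y' := fun h => hxy (congrArg Subtype.val h)
  -- The combination of the two unit vectors, unique up to scaling, that the linear form kills,
  -- since its coefficients there are s and t.
  let h : α → ℝ := t • Pi.single x 1 - s • Pi.single y 1
  have hh : (fun z : tops r S => h z) = t • Pi.single x' 1 - s • Pi.single y' 1 := by
    ext z
    simp [h, Pi.single_apply, Subtype.ext_iff, x', y']
  have hlin : linForm r N S h = 0 := by
    have h1 : linForm r N S h = (fun z : tops r S => N (S.erase z)) ⬝ᵥ fun z : tops r S => h z :=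
      (Finset.sum_coe_sort (tops r S) fun x => N (S.erase x) * h x).symm
    rw [h1, hh]
    simp only [dotProduct_sub, dotProduct_smul, dotProduct_single_one, smul_eq_mul]
    change t * s - s * t = 0
    ring
  have hquad := quadForm_nonpos hN hrec S h hlin
  have hMxx : pairMatrix r N S x' x' = p := if_pos rfl
  have hMyy : pairMatrix r N S y' y' = q := if_pos rfl
  have hMxy : pairMatrix r N S x' y' = m := if_neg hxy
  have hMyx : pairMatrix r N S y' x' = m := by
    rw [← hMxy, ← congrFun (congrFun (pairMatrix_transpose S) x') y', transpose_apply]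
  rw [quadForm_eq, hh] at hquad
  simp only [mulVec_sub, mulVec_smul, sub_dotProduct, dotProduct_sub, smul_dotProduct,
    dotProduct_smul, mulVec_single_one, single_one_dotProduct, col_apply, smul_eq_mul,
    hMxx, hMyy, hMxy, hMyx] at hquad
  have h1 : t ^ 2 * p + s ^ 2 * q ≤ 2 * (s * t * m) := by nlinarith
  have h2 : (t ^ 2 * p + s ^ 2 * q) ^ 2 ≤ (2 * (s * t * m)) ^ 2 :=
    pow_le_pow_left₀ (by positivity) h1 2
  -- AM-GM for t²p and s²q.
  have h3 : 4 * (s * t) ^ 2 * (p * q) ≤ 4 * (s * t) ^ 2 * m ^ 2 := by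
    nlinarith [sq_nonneg (t ^ 2 * p - s ^ 2 * q)]
  exact le_of_mul_le_mul_left h3 (by positivity)

end RecursiveCounts

/-! ### The inequality for linear extensions -/

section LinearExtensions

variable {α : Type*} [DecidableEq α] {r : α → α → Prop}

theorem ncard_linearLabellings_mul_le_sq (rank : α → ℕ) (hrank : ∀ a b, r a b → rank a < rank b)
    {S : Finset α} {x y v w : α} (hx : x ∈ tops r S) (hy : y ∈ tops r S)
    (hv : v ∈ tops r (S.erase x)) (hv' : v ∉ tops r S)
    (hw : w ∈ tops r (S.erase y)) (hw' : w ∉ tops r S) :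
    (linearLabellings r ((S.erase x).erase v)).ncard *
      (linearLabellings r ((S.erase y).erase w)).ncard ≤
      (linearLabellings r ((S.erase x).erase y)).ncard ^ 2 := by
  have hirr : ∀ a, ¬ r a a := fun a h => (hrank a a h).ne rfl
  rcases eq_or_ne x y with rfl | hxy
  -- For x = y the right side is N(S-x)², and each factor on the left is one summand in the
  -- recursion for N(S-x).
  · have hle : ∀ u ∈ tops r (S.erase x), (linearLabellings r ((S.erase x).erase u)).ncard ≤
        (linearLabellings r (S.erase x)).ncard := by
      intro u hu
      rw [ncard_linearLabellings_eq_sum hirr ⟨u, mem_of_mem_tops hu⟩]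
      exact Finset.single_le_sum
        (f := fun u => (linearLabellings r ((S.erase x).erase u)).ncard)
        (fun _ _ => Nat.zero_le _) hu
    rw [Finset.erase_idem, sq]
    exact Nat.mul_le_mul (hle v hv) (hle w hw)
  · have hmain := sum_mul_sum_le_sq (r := r)
      (N := fun S => ((linearLabellings r S).ncard : ℝ))
      (fun S => Nat.cast_pos.mpr (ncard_linearLabellings_pos rank hrank S))
      (fun S hS => by
        rw [ncard_linearLabellings_eq_sum hirr hS]
        push_cast
        rfl) hx hy hxy
    have hterm : ∀ z u, u ∈ tops r (S.erase z) → u ∉ tops r S →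
        ((linearLabellings r ((S.erase z).erase u)).ncard : ℝ) ≤
        ∑ v ∈ tops r (S.erase z) \ tops r S,
          ((linearLabellings r ((S.erase z).erase v)).ncard : ℝ) := fun z u hu hu' =>
      Finset.single_le_sum
        (f := fun v => ((linearLabellings r ((S.erase z).erase v)).ncard : ℝ))
        (fun _ _ => Nat.cast_nonneg _) (Finset.mem_sdiff.mpr ⟨hu, hu'⟩)
    have := (mul_le_mul (hterm x v hv hv') (hterm y w hw hw') (Nat.cast_nonneg _)
      (Finset.sum_nonneg fun _ _ => Nat.cast_nonneg _)).trans hmain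
    exact_mod_cast this

end LinearExtensions

/-! ### Skew tableaux as linear extensions -/

/-- `a` is strictly before `b` in the same row or in the same column. -/
def RowColumnLT (a b : ℕ × ℕ) : Prop :=
  (a.1 = b.1 ∧ a.2 < b.2) ∨ (a.2 = b.2 ∧ a.1 < b.1)

theorem RowColumnLT.add_lt_add {a b : ℕ × ℕ} (h : RowColumnLT a b) : a.1 + a.2 < b.1 + b.2 := by
  unfold RowColumnLT at h
  omega

theorem ncard_SYT (S : Finset (ℕ × ℕ)) :
    (SYT S).ncard = (linearLabellings RowColumnLT S).ncard := by
  let φ : (S ≃ Fin S.card) → ℕ × ℕ → ℕ := fun f a => if ha : a ∈ S then f ⟨a, ha⟩ else 0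
  have hφ : ∀ f (a : S), φ f a = f a := fun f a => by simp [φ]
  have hinj : Set.InjOn φ (SYT S) := by
    intro f _ g _ hfg
    ext a
    rw [← hφ, ← hφ, hfg]
  rw [← hinj.ncard_image]
  congr 1
  ext g
  constructor
  · rintro ⟨f, hf, rfl⟩
    refine ⟨fun a ha => by simp [φ, ha], fun a ha => ?_, fun a ha b hb hab => ?_,
      fun a ha b hb hab => ?_⟩
    · rw [hφ f ⟨a, ha⟩]
      exact (f ⟨a, ha⟩).2
    · rw [hφ f ⟨a, ha⟩, hφ f ⟨b, hb⟩] at hab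
      exact congrArg Subtype.val (f.injective (Fin.ext hab))
    · rw [hφ f ⟨a, ha⟩, hφ f ⟨b, hb⟩]
      rcases hab with hab | hab
      · exact hf.1 ⟨a, ha⟩ ⟨b, hb⟩ hab.1 hab.2
      · exact hf.2 ⟨a, ha⟩ ⟨b, hb⟩ hab.1 hab.2
  · rintro ⟨h0, hlt, hginj, hmono⟩
    let f₀ : S → Fin S.card := fun a => ⟨g a, hlt a a.2⟩
    have hf₀ : Function.Bijective f₀ := by
      refine (Fintype.bijective_iff_injective_and_card f₀).mpr ⟨fun a b hab => ?_, by simp⟩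
      exact Subtype.ext (hginj a.2 b.2 (congrArg Fin.val hab))
    refine ⟨Equiv.ofBijective f₀ hf₀, ⟨fun a b hr hlt => ?_, fun a b hr hlt => ?_⟩, ?_⟩
    · exact hmono a a.2 b b.2 (Or.inl ⟨hr, hlt⟩)
    · exact hmono a a.2 b b.2 (Or.inr ⟨hr, hlt⟩)
    · ext a
      by_cases ha : a ∈ S
      · rw [hφ _ ⟨a, ha⟩]
        rfl
      · simp [φ, ha, h0 a ha]

theorem comp_swap_mem_linearLabellings {S T : Finset (ℕ × ℕ)} (hST : ∀ a, a.swap ∈ T ↔ a ∈ S)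
    (hcard : T.card = S.card) {g : ℕ × ℕ → ℕ} (hg : g ∈ linearLabellings RowColumnLT T) :
    g ∘ Prod.swap ∈ linearLabellings RowColumnLT S := by
  obtain ⟨h0, hlt, hinj, hmono⟩ := hg
  refine ⟨fun a ha => h0 _ (mt (hST a).mp ha), fun a ha => hcard ▸ hlt _ ((hST a).mpr ha),
    fun a ha b hb hab => ?_, fun a ha b hb hab => ?_⟩
  · exact Prod.swap_injective (hinj ((hST a).mpr ha) ((hST b).mpr hb) hab)
  · exact hmono _ ((hST a).mpr ha) _ ((hST b).mpr hb) (Or.symm hab)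

theorem ncard_SYT_swap {S T : Finset (ℕ × ℕ)} (hST : ∀ a, a.swap ∈ T ↔ a ∈ S) :
    (SYT S).ncard = (SYT T).ncard := by
  have hTS : ∀ a, a.swap ∈ S ↔ a ∈ T := fun a => by rw [← hST, Prod.swap_swap]
  have hcard : T.card = S.card := by
    refine (Finset.card_bij' (fun a _ => a.swap) (fun a _ => a.swap) ?_ ?_ ?_ ?_).symm
    · exact fun a ha => (hST a).mpr ha
    · exact fun a ha => (hTS a).mpr ha
    · exact fun a _ => a.swap_swap
    · exact fun a _ => a.swap_swap
  rw [ncard_SYT, ncard_SYT]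
  refine Set.ncard_congr (fun g _ => g ∘ Prod.swap) ?_ ?_ ?_
  · exact fun g hg => comp_swap_mem_linearLabellings hTS hcard.symm hg
  · intro g g' _ _ h
    ext a
    simpa using congrFun h a.swap
  · exact fun g hg => ⟨g ∘ Prod.swap, comp_swap_mem_linearLabellings hST hcard hg, by
      ext a; simp⟩

theorem mem_skewCells {lam mu : YoungDiagram} {c : ℕ × ℕ} :
    c ∈ skewCells lam mu ↔ c ∈ lam ∧ c ∉ mu := by
  simp [skewCells, YoungDiagram.mem_cells]

/-- A corner of the skew shape is a corner of `lam`: a neighbour below or to the right lying in `mu`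
would pull the square itself into `mu`. -/
theorem notMem_of_mem_cornerSquares {lam mu : YoungDiagram} {x : ℕ × ℕ}
    (hx : x ∈ cornerSquares (skewCells lam mu)) :
    (x.1 + 1, x.2) ∉ lam ∧ (x.1, x.2 + 1) ∉ lam := by
  obtain ⟨h1, h2, h3⟩ := hx
  rw [mem_skewCells] at h1 h2 h3
  refine ⟨fun h => h2 ⟨h, fun hmu => h1.2 ?_⟩, fun h => h3 ⟨h, fun hmu => h1.2 ?_⟩⟩
  · exact mu.up_left_mem (Nat.le_succ _) le_rfl hmu
  · exact mu.up_left_mem le_rfl (Nat.le_succ _) hmu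

theorem mem_tops_of_mem_cornerSquares {lam mu : YoungDiagram} {x : ℕ × ℕ}
    (hx : x ∈ cornerSquares (skewCells lam mu)) : x ∈ tops RowColumnLT (skewCells lam mu) := by
  obtain ⟨h1, h2⟩ := notMem_of_mem_cornerSquares hx
  refine mem_tops.mpr ⟨hx.1, ?_⟩
  rintro ⟨i, j⟩ hy hxy
  have hlam := (mem_skewCells.mp hy).1
  rcases hxy with ⟨hi, hj⟩ | ⟨hj, hi⟩
  · exact h2 (lam.up_left_mem hi.le hj hlam)
  · exact h1 (lam.up_left_mem hi hj.le hlam)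

/-- As x is a corner of `lam`, v lies directly left of it or above it. Past x nothing follows in
that line, and the other neighbour of v is outside `lam` because v is a boundary square; hence x
alone keeps v from being a top. -/
theorem mem_tops_erase_of_adjacentSquares {lam mu : YoungDiagram} {x v : ℕ × ℕ}
    (hx : x ∈ cornerSquares (skewCells lam mu)) (hv : v ∈ boundarySquares lam.cells)
    (hvS : v ∈ skewCells lam mu) (hvx : AdjacentSquares v x) :
    v ∈ tops RowColumnLT ((skewCells lam mu).erase x) ∧
      v ∉ tops RowColumnLT (skewCells lam mu) := by
  obtain ⟨h1, h2⟩ := notMem_of_mem_cornerSquares hx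
  have hvlam := (mem_skewCells.mp hvS).1
  have hxlam := (mem_skewCells.mp hx.1).1
  have hvb : (v.1 + 1, v.2) ∉ lam ∨ (v.1, v.2 + 1) ∉ lam := hv.2
  have hprec : PrecedesAdjacent v x := by
    refine hvx.resolve_right ?_
    rintro (rfl | rfl)
    · exact h2 hvlam
    · exact h1 hvlam
  have hr : RowColumnLT v x := by
    rcases hprec with rfl | rfl
    · exact Or.inl ⟨rfl, Nat.lt_succ_self _⟩
    · exact Or.inr ⟨rfl, Nat.lt_succ_self _⟩
  have hne : v ≠ x := by
    rintro rfl
    exact lt_irrefl _ hr.add_lt_add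
  refine ⟨mem_tops.mpr ⟨Finset.mem_erase.mpr ⟨hne, hvS⟩, ?_⟩,
    fun h => (mem_tops.mp h).2 x hx.1 hr⟩
  rintro ⟨i, j⟩ hy hvy
  obtain ⟨hyx, hyS⟩ := Finset.mem_erase.mp hy
  have hylam := (mem_skewCells.mp hyS).1
  rcases hprec with rfl | rfl
  · have hb := hvb.resolve_right (not_not.mpr hxlam)
    rcases hvy with ⟨hi, hj⟩ | ⟨hj, hi⟩
    · refine h2 (lam.up_left_mem hi.le ?_ hylam)
      have : j ≠ v.2 + 1 := fun h => hyx (Prod.ext hi.symm h)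
      simp only at hj ⊢
      omega
    · exact hb (lam.up_left_mem hi hj.le hylam)
  · have hb := hvb.resolve_left (not_not.mpr hxlam)
    rcases hvy with ⟨hi, hj⟩ | ⟨hj, hi⟩
    · exact hb (lam.up_left_mem hi.le hj hylam)
    · refine h1 (lam.up_left_mem ?_ hj.le hylam)
      have : i ≠ v.1 + 1 := fun h => hyx (Prod.ext h hj.symm)
      simp only at hi ⊢
      omega

theorem sdiff_pair_eq_erase_erase (S : Finset (ℕ × ℕ)) (a b : ℕ × ℕ) :
    S \ {a, b} = (S.erase a).erase b := by
  ext c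
  simp only [Finset.mem_sdiff, Finset.mem_insert, Finset.mem_singleton, Finset.mem_erase]
  tauto

theorem ncard_SYT_mul_le_sq {lam mu : YoungDiagram} {x y v w : ℕ × ℕ}
    (hx : x ∈ cornerSquares (skewCells lam mu)) (hy : y ∈ cornerSquares (skewCells lam mu))
    (hv : v ∈ boundarySquares lam.cells) (hvS : v ∈ skewCells lam mu) (hvx : AdjacentSquares v x)
    (hw : w ∈ boundarySquares lam.cells) (hwS : w ∈ skewCells lam mu) (hwy : AdjacentSquares w y) :
    (SYT (skewCells lam mu \ {x, v})).ncard * (SYT (skewCells lam mu \ {y, w})).ncard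
      ≤ (SYT (skewCells lam mu \ {x, y})).ncard ^ 2 := by
  obtain ⟨h1, h2⟩ := mem_tops_erase_of_adjacentSquares hx hv hvS hvx
  obtain ⟨h3, h4⟩ := mem_tops_erase_of_adjacentSquares hy hw hwS hwy
  simp only [ncard_SYT, sdiff_pair_eq_erase_erase]
  exact ncard_linearLabellings_mul_le_sq (fun a => a.1 + a.2) (fun _ _ => RowColumnLT.add_lt_add)
    (mem_tops_of_mem_cornerSquares hx) (mem_tops_of_mem_cornerSquares hy) h1 h2 h3 h4

theorem swap_mem_iff_of_transpose_eq {lam : YoungDiagram} (h : lam.transpose = lam) (c : ℕ × ℕ) :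
    c.swap ∈ lam ↔ c ∈ lam := by
  rw [← YoungDiagram.mem_transpose, h]

theorem adjacentSquares_swap {a b : ℕ × ℕ} (h : AdjacentSquares a b) :
    AdjacentSquares a.swap b.swap := by
  rcases h with (rfl | rfl) | (rfl | rfl)
  · exact Or.inl (Or.inr rfl)
  · exact Or.inl (Or.inl rfl)
  · exact Or.inr (Or.inr rfl)
  · exact Or.inr (Or.inl rfl)

theorem corollaryc (lam mu : YoungDiagram) (hsub : mu ≤ lam) :
    (∀ x y v w : ℕ × ℕ,
      x ∈ cornerSquares (skewCells lam mu) →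
      y ∈ cornerSquares (skewCells lam mu) →
      v ∈ boundarySquares lam.cells → v ∈ skewCells lam mu → AdjacentSquares v x →
      w ∈ boundarySquares lam.cells → w ∈ skewCells lam mu → AdjacentSquares w y →
      (SYT (skewCells lam mu \ {x, v})).ncard * (SYT (skewCells lam mu \ {y, w})).ncard
        ≤ (SYT (skewCells lam mu \ {x, y})).ncard ^ 2) ∧
    (lam.transpose = lam → mu.transpose = mu →
      ∀ (i j : ℕ) (v : ℕ × ℕ),
        (i, j) ∈ cornerSquares (skewCells lam mu) →
        v ∈ boundarySquares lam.cells → v ∈ skewCells lam mu → AdjacentSquares v (i, j) →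
        (SYT (skewCells lam mu \ {(i, j), v})).ncard
          ≤ (SYT (skewCells lam mu \ {(i, j), (j, i)})).ncard) := by
  refine ⟨fun x y v w hx hy hv hvS hvx hw hwS hwy =>
    ncard_SYT_mul_le_sq hx hy hv hvS hvx hw hwS hwy, fun hlam hmu i j v hx hv hvS hvx => ?_⟩
  have hswap : ∀ c : ℕ × ℕ, c.swap ∈ skewCells lam mu ↔ c ∈ skewCells lam mu := fun c => by
    rw [mem_skewCells, mem_skewCells, swap_mem_iff_of_transpose_eq hlam,
      swap_mem_iff_of_transpose_eq hmu]
  have hy : (j, i) ∈ cornerSquares (skewCells lam mu) :=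
    ⟨(hswap (i, j)).mpr hx.1, fun h => hx.2.2 ((hswap (i, j + 1)).mp h),
      fun h => hx.2.1 ((hswap (i + 1, j)).mp h)⟩
  have hw : v.swap ∈ boundarySquares lam.cells := by
    refine ⟨(swap_mem_iff_of_transpose_eq hlam v).mpr hv.1, hv.2.symm.imp ?_ ?_⟩
    · exact fun h h' => h ((swap_mem_iff_of_transpose_eq hlam (v.1, v.2 + 1)).mp h')
    · exact fun h h' => h ((swap_mem_iff_of_transpose_eq hlam (v.1 + 1, v.2)).mp h')
  -- Apply the first part with y and w the reflections of x and v.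
  have hmain := ncard_SYT_mul_le_sq hx hy hv hvS hvx hw ((hswap v).mpr hvS)
    (adjacentSquares_swap hvx)
  have heq : (SYT (skewCells lam mu \ {(i, j), v})).ncard =
      (SYT (skewCells lam mu \ {(j, i), v.swap})).ncard := by
    refine ncard_SYT_swap fun a => ?_
    have h1 : a.swap = (j, i) ↔ a = (i, j) := Prod.swap_injective.eq_iff (b := (i, j))
    have h2 : a.swap = v.swap ↔ a = v := Prod.swap_injective.eq_iff
    simp only [Finset.mem_sdiff, hswap, Finset.mem_insert, Finset.mem_singleton, h1, h2]
  rw [← heq, ← sq] at hmain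
  exact (Nat.pow_le_pow_iff_left two_ne_zero).mp hmain
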